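/- Let $X$ be a separable infinite-dimensional complex Banach space and let $\mathcal B(X)$ be the space of bounded linear operators on $X$ with the operator norm. An operator $B\in\mathcal B(X)$ is called a generalised backward $1$-shift if there are linearly independent vectors $x_1,x_2,\dots$ in $X$ whose linear span is dense in $X$ and scalars $a^k_i\in\mathbb C$ ($1\le i<k$) such that $Bx_k=\sum_{i=1}^{k-1}a^k_i x_i$ for every $k\ge 1$ (so $Bx_1=0$) and $a^k_{k-1}\ne 0$ for every $k\ge 2$. An operator $T\in\mathcal B(X)$ is called mixing if for every pair of nonempty open sets $U,V\subseteq X$ there is $N$ such that $T^n(U)\cap V\neq\emptyset$ for all $n>N$. Let $S\in\mathcal B(X)$ be such that its generalised kernel $\bigcup_{n=1}^\infty\ker(S^n)$ is dense in $X$. Then $S$ lies in the operator-norm closure of the set of generalised backward $1$-shifts on $X$, and for every $\lambda\in\mathbb C$ with $|\lambda|=1$ the operator $\lambda I+S$ lies in the operator-norm closure of the set of mixing operators on $X$. -/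

import Mathlib

/-- The generalised kernel `⋃_{n ≥ 1} ker (T ^ n)` of a bounded operator. -/
def generalisedKernel {X : Type*} [NormedAddCommGroup X] [NormedSpace ℂ X]
    (T : X →L[ℂ] X) : Set X :=
  ⋃ n : ℕ, ⋃ _ : 1 ≤ n, {x : X | (T ^ n) x = 0}

/-- `T` is mixing: for all nonempty open `U, V` there is `N` such that `T ^ n (U)` meets `V`
for every `n > N`. -/
def IsMixingOperator {X : Type*} [NormedAddCommGroup X] [NormedSpace ℂ X]
    (T : X →L[ℂ] X) : Prop :=
  ∀ U V : Set X, IsOpen U → IsOpen V → U.Nonempty → V.Nonempty →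
    ∃ N : ℕ, ∀ n : ℕ, N < n → (((T ^ n) '' U) ∩ V).Nonempty

/-- `S` is a generalised backward shift adapted to the doubly indexed family `x`, whose chains
are indexed by a linear order `ι` and whose positions in a chain are indexed by `ℕ`
(starting from `0`). The family is linearly independent with dense span, and each `S (x (l, k))`
is a finite linear combination (with coefficients `c`) of vectors whose index is
lexicographically smaller than `(l, k)`, the coefficient of the immediate predecessor
`x (l, k - 1)` being nonzero unless `x (l, k)` is the first vector of its chain. -/
structure IsGeneralisedBackwardShiftAdapted {X : Type*} [NormedAddCommGroup X] [NormedSpace ℂ X]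
    {ι : Type*} [LinearOrder ι] (S : X →L[ℂ] X) (x : ι × ℕ → X) : Prop where
  linearIndependent : LinearIndependent ℂ x
  dense_span : Dense (Submodule.span ℂ (Set.range x) : Set X)
  shift : ∀ (l : ι) (k : ℕ), ∃ c : ι × ℕ →₀ ℂ,
    S (x (l, k)) = Finsupp.linearCombination ℂ x c ∧
    (∀ i ∈ c.support, toLex i < toLex (l, k)) ∧
    (0 < k → c (l, k - 1) ≠ 0)

/-- `S` is a generalised backward `n`-shift: it is adapted to some family with `n` chains. -/
def IsGeneralisedBackwardShift {X : Type*} [NormedAddCommGroup X] [NormedSpace ℂ X]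
    (n : ℕ) (S : X →L[ℂ] X) : Prop :=
  ∃ x : Fin n × ℕ → X, IsGeneralisedBackwardShiftAdapted S x

/-!
An operator with dense generalised kernel is strictly upper triangular along a linearly
independent sequence with dense span, and a small perturbation of its superdiagonal turns it into
a backward shift `B`. Every vector in the span of the sequence lies in the extended kernel of `B`:
it is `B ^ n u` for some `u` with `B ^ (2 * n) u = 0`. Along the nilpotent orbit of `u`, Newton's
forward difference formula realises `1 + B` as the translation `f ↦ f (· + 1)` on polynomials of
degree less than `2 * n`. If `q` has degree less than `n`, then `q(x) * (1 - x / c) ^ n` has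
degree less than `2 * n` and, for large `|c|`, is close to `q` near `0` and close to `0` near `c`.
So for `c = k` the `k`-th power of `1 + B` sends points near `B ^ n u` close to `0`, and for
`c = -k` points near `0` close to `B ^ n u`, which gives mixing. For `z + B = z * (1 + z⁻¹ * B)`
with `|z| = 1`, the powers of `z` do not affect these limits.
-/

open Bornology Filter Set Topology

section InitialSpan

variable {K V : Type*} [Field K] [AddCommGroup V] [Module K V] {e : ℕ → V}

variable (K) in
/-- The `n`-th member of the flag spanned by a sequence: the span of the vectors `e i` with
`i < n`. -/
def initialSpan (e : ℕ → V) (n : ℕ) : Submodule K V :=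
  Submodule.span K (e '' Iio n)

theorem initialSpan_zero : initialSpan K e 0 = ⊥ := by
  simp [initialSpan]

theorem initialSpan_succ (n : ℕ) :
    initialSpan K e (n + 1) = initialSpan K e n ⊔ Submodule.span K {e n} := by
  rw [initialSpan, ← Order.succ_eq_add_one, Order.Iio_succ_eq_insert,
    image_insert_eq, Submodule.span_insert, sup_comm, initialSpan]

theorem initialSpan_mono : Monotone (initialSpan K e) :=
  fun _ _ h => Submodule.span_mono (image_mono (Iio_subset_Iio h))

theorem apply_mem_initialSpan {m n : ℕ} (h : m < n) : e m ∈ initialSpan K e n :=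
  Submodule.subset_span (mem_image_of_mem e h)

theorem initialSpan_le_span_range (n : ℕ) : initialSpan K e n ≤ Submodule.span K (range e) :=
  Submodule.span_mono (image_subset_range e _)

theorem span_range_le_of_initialSpan_le {p : Submodule K V} (h : ∀ n, initialSpan K e n ≤ p) :
    Submodule.span K (range e) ≤ p :=
  Submodule.span_le.2 (range_subset_iff.2 fun n => h (n + 1) (apply_mem_initialSpan n.lt_succ_self))

instance finiteDimensional_initialSpan (n : ℕ) : FiniteDimensional K (initialSpan K e n) :=
  FiniteDimensional.span_of_finite K ((finite_Iio n).image e)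

theorem linearIndependent_of_notMem_initialSpan (he : ∀ n, e n ∉ initialSpan K e n) :
    LinearIndependent K e := by
  have hIio : ∀ n, LinearIndepOn K e (Iio n) := by
    intro n
    induction n with
    | zero => simp
    | succ n ih =>
      rw [← Order.succ_eq_add_one, Order.Iio_succ_eq_insert]
      exact ih.insert (he n)
  rw [← linearIndepOn_univ_iff, ← iUnion_Iio]
  exact linearIndepOn_iUnion_of_directed
    (Monotone.directed_le fun _ _ h => Iio_subset_Iio h) hIio

open Classical in
theorem initialSpan_comp_nth (w : ℕ → V) (n : ℕ) :
    initialSpan K (w ∘ Nat.nth fun k => w k ∉ initialSpan K w k)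
      (Nat.count (fun k => w k ∉ initialSpan K w k) n) = initialSpan K w n := by
  induction n with
  | zero => simp only [Nat.count_zero, initialSpan_zero]
  | succ n ih =>
    rw [Nat.count_succ, initialSpan_succ]
    by_cases hn : w n ∈ initialSpan K w n
    · rw [if_neg (not_not.2 hn), add_zero, ih, eq_comm, sup_eq_left]
      exact (Submodule.span_singleton_le_iff_mem _ _).2 hn
    · rw [if_pos hn, initialSpan_succ, ih, Function.comp_apply,
        Nat.nth_count (p := fun k => w k ∉ initialSpan K w k) hn]

theorem infinite_setOf_notMem_initialSpan {w : ℕ → V}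
    (hw : ¬ FiniteDimensional K (Submodule.span K (range w))) :
    {k | w k ∉ initialSpan K w k}.Infinite := by
  classical
  intro hfin
  have hle : Submodule.span K (range w) ≤ initialSpan K (w ∘ Nat.nth fun k =>
      w k ∉ initialSpan K w k) hfin.toFinset.card := by
    refine span_range_le_of_initialSpan_le fun n => ?_
    rw [← initialSpan_comp_nth]
    exact initialSpan_mono (Nat.count_le_card hfin n)
  exact hw (Submodule.finiteDimensional_of_le hle)

/-- Discarding the vectors that depend linearly on their predecessors does not change the flag. -/
theorem exists_linearIndependent_comp_initialSpan_eq {w : ℕ → V}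
    (hw : ¬ FiniteDimensional K (Submodule.span K (range w))) :
    ∃ φ : ℕ → ℕ, StrictMono φ ∧ LinearIndependent K (w ∘ φ) ∧
      ∀ k, initialSpan K (w ∘ φ) k = initialSpan K w (φ k) := by
  classical
  have hinf := infinite_setOf_notMem_initialSpan hw
  have hflag : ∀ k, initialSpan K (w ∘ Nat.nth fun k => w k ∉ initialSpan K w k) k =
      initialSpan K w (Nat.nth (fun k => w k ∉ initialSpan K w k) k) := fun k => by
    rw [← initialSpan_comp_nth w (Nat.nth _ k), Nat.count_nth_of_infinite hinf]
  refine ⟨_, Nat.nth_strictMono hinf, linearIndependent_of_notMem_initialSpan fun k => ?_, hflag⟩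
  rw [hflag]
  exact Nat.nth_mem_of_infinite hinf k

end InitialSpan

section Triangular

theorem sup_span_singleton_eq_of_sub_mem {R M : Type*} [Ring R] [AddCommGroup M] [Module R M]
    {p : Submodule R M} {x y : M} (h : x - y ∈ p) :
    p ⊔ Submodule.span R {x} = p ⊔ Submodule.span R {y} := by
  have hle : ∀ {x y : M}, x - y ∈ p → p ⊔ Submodule.span R {x} ≤ p ⊔ Submodule.span R {y} :=
    fun {x y} h => sup_le le_sup_left <| (Submodule.span_singleton_le_iff_mem _ _).2 <|
      sub_add_cancel x y ▸ Submodule.add_mem_sup h (Submodule.mem_span_singleton_self y)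
  exact le_antisymm (hle h) (hle (sub_mem_comm_iff.1 h))

variable {K V : Type*} [Field K] [AddCommGroup V] [Module K V]

/-- `T` is strictly upper triangular along `e`: it maps each vector of the sequence into the span
of the preceding ones. -/
def IsStrictlyTriangularAlong (T : Module.End K V) (e : ℕ → V) : Prop :=
  ∀ k, T (e k) ∈ initialSpan K e k

/-- The nilpotent orbit of `v`, read backwards from its last nonzero term. -/
theorem exists_isStrictlyTriangularAlong_of_pow_apply_eq_zero {T : Module.End K V} {n : ℕ} {v : V}
    (hv : (T ^ (n + 1)) v = 0) : ∃ y : ℕ → V, IsStrictlyTriangularAlong T y ∧ v ∈ range y := by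
  set y : ℕ → V := fun i => if i ≤ n then (T ^ (n - i)) v else 0 with hy
  have happly : ∀ i, T (y i) = if i ≤ n then (T ^ (n - i + 1)) v else 0 := fun i => by
    rw [apply_ite T, map_zero, pow_succ', Module.End.mul_apply]
  refine ⟨y, fun i => ?_, n, by simp [hy]⟩
  rw [happly]
  split_ifs with hi
  · cases i with
    | zero =>
      rw [Nat.sub_zero, hv]
      exact zero_mem _
    | succ i =>
      have hyi : (T ^ (n - (i + 1) + 1)) v = y i := by
        rw [hy]
        dsimp only
        rw [if_pos (by omega)]
        congr 2
        omega
      rw [hyi]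
      exact apply_mem_initialSpan i.lt_succ_self
  · exact zero_mem _

theorem IsStrictlyTriangularAlong.unpair {T : Module.End K V} {y : ℕ → ℕ → V}
    (hy : ∀ j, IsStrictlyTriangularAlong T (y j)) :
    IsStrictlyTriangularAlong T fun k => y k.unpair.1 k.unpair.2 := by
  intro k
  obtain ⟨⟨j, i⟩, rfl⟩ := Nat.pairEquiv.surjective k
  have hle : initialSpan K (y j) i ≤
      initialSpan K (fun k => y k.unpair.1 k.unpair.2) (Nat.pair j i) := by
    refine Submodule.span_mono ?_
    rintro _ ⟨i', hi', rfl⟩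
    exact ⟨Nat.pair j i', Nat.pair_lt_pair_right j hi', by simp⟩
  simpa using hle (hy j i)

/-- `B` is a backward shift along `e`, up to lower order terms: the one-chain case of
`IsGeneralisedBackwardShiftAdapted`, expressed through the flag of `e` instead of coefficients. -/
structure IsBackwardShiftAlong (B : Module.End K V) (e : ℕ → V) : Prop where
  apply_zero : B (e 0) = 0
  apply_succ : ∀ k, ∃ a : K, a ≠ 0 ∧ B (e (k + 1)) - a • e k ∈ initialSpan K e k

/-- Shkarin's extended kernel `ker† T`, the span of the spaces `T ^ n (ker (T ^ (2 * n)))`. -/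
def extendedKernel (T : Module.End K V) : Submodule K V :=
  ⨆ n : ℕ, (LinearMap.ker (T ^ (2 * n))).map (T ^ n)

theorem extendedKernel_smul (T : Module.End K V) {c : K} (hc : c ≠ 0) :
    extendedKernel (c • T) = extendedKernel T := by
  simp only [extendedKernel, smul_pow, LinearMap.ker_smul _ _ (pow_ne_zero _ hc),
    Submodule.map_smul _ _ _ (pow_ne_zero _ hc)]

namespace IsBackwardShiftAlong

variable {B : Module.End K V} {e : ℕ → V}

theorem map_initialSpan_succ (hB : IsBackwardShiftAlong B e) (n : ℕ) :
    (initialSpan K e (n + 1)).map B = initialSpan K e n := by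
  induction n with
  | zero =>
    rw [initialSpan_succ, initialSpan_zero, bot_sup_eq, Submodule.map_span, image_singleton,
      hB.apply_zero, Submodule.span_zero_singleton]
  | succ n ih =>
    obtain ⟨a, ha, hmem⟩ := hB.apply_succ n
    rw [initialSpan_succ (n + 1), Submodule.map_sup, ih, Submodule.map_span, image_singleton,
      initialSpan_succ n]
    rw [sup_span_singleton_eq_of_sub_mem hmem,
      Submodule.span_singleton_smul_eq (isUnit_iff_ne_zero.2 ha)]

theorem map_pow_initialSpan (hB : IsBackwardShiftAlong B e) (n j : ℕ) :
    (initialSpan K e (n + j)).map (B ^ j) = initialSpan K e n := by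
  induction j with
  | zero => rw [pow_zero, Module.End.one_eq_id, Submodule.map_id, add_zero]
  | succ j ih =>
    rw [pow_succ, Module.End.mul_eq_comp, Submodule.map_comp, ← add_assoc,
      hB.map_initialSpan_succ, ih]

theorem initialSpan_le_ker_pow (hB : IsBackwardShiftAlong B e) (n : ℕ) :
    initialSpan K e n ≤ LinearMap.ker (B ^ n) := by
  have hmap := hB.map_pow_initialSpan 0 n
  rwa [zero_add, initialSpan_zero, ← LinearMap.le_ker_iff_map] at hmap

theorem span_range_le_extendedKernel (hB : IsBackwardShiftAlong B e) :
    Submodule.span K (range e) ≤ extendedKernel B := by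
  refine span_range_le_of_initialSpan_le fun n => ?_
  calc initialSpan K e n = (initialSpan K e (2 * n)).map (B ^ n) := by
        rw [two_mul, hB.map_pow_initialSpan]
    _ ≤ (LinearMap.ker (B ^ (2 * n))).map (B ^ n) :=
        Submodule.map_mono (hB.initialSpan_le_ker_pow (2 * n))
    _ ≤ extendedKernel B := le_iSup (fun n => (LinearMap.ker (B ^ (2 * n))).map (B ^ n)) n

end IsBackwardShiftAlong

end Triangular

section GeneralisedKernel

variable {X : Type*} [NormedAddCommGroup X] [NormedSpace ℂ X]

theorem isGeneralisedBackwardShift_one {B : X →L[ℂ] X} {e : ℕ → X} (hli : LinearIndependent ℂ e)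
    (hd : Dense (Submodule.span ℂ (range e) : Set X))
    (hB : IsBackwardShiftAlong (B : X →ₗ[ℂ] X) e) : IsGeneralisedBackwardShift 1 B := by
  have hrange : range (fun i : Fin 1 × ℕ => e i.2) = range e :=
    Prod.snd_surjective.range_comp e
  refine ⟨fun i => e i.2, hli.comp Prod.snd (Equiv.uniqueProd ℕ (Fin 1)).injective,
    hrange ▸ hd, fun l k => ?_⟩
  have hlt : ∀ i : Fin 1 × ℕ, i.2 < k → toLex i < toLex (l, k) := fun i hi =>
    Prod.Lex.toLex_lt_toLex.2 (Or.inr ⟨Subsingleton.elim _ _, hi⟩)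
  cases k with
  | zero => exact ⟨0, by simpa using hB.apply_zero, by simp, by simp⟩
  | succ k =>
    obtain ⟨a, ha, hmem⟩ := hB.apply_succ k
    have himage : e '' Iio k = (fun i : Fin 1 × ℕ => e i.2) '' (Prod.snd ⁻¹' Iio k) := by
      rw [← image_image e Prod.snd, image_preimage_eq _ Prod.snd_surjective]
    rw [initialSpan, himage, Finsupp.mem_span_image_iff_linearCombination] at hmem
    obtain ⟨c, hc, hsum⟩ := hmem
    have hck : c (l, k) = 0 := (Finsupp.mem_supported' ℂ c).1 hc (l, k) (lt_irrefl k)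
    refine ⟨Finsupp.single (l, k) a + c, ?_, fun i hi => hlt i ?_, fun _ => ?_⟩
    · rw [map_add, hsum, Finsupp.linearCombination_single]
      exact (add_sub_cancel _ _).symm
    · rcases Finset.mem_union.1 (Finsupp.support_add hi) with hi | hi
      · rw [Finset.mem_singleton.1 (Finsupp.support_single_subset hi)]
        exact k.lt_succ_self
      · exact Nat.lt_succ_of_lt ((Finsupp.mem_supported ℂ c).1 hc hi)
    · simpa [hck] using ha

theorem mem_generalisedKernel {T : X →L[ℂ] X} {x : X} :
    x ∈ generalisedKernel T ↔ ∃ n : ℕ, ((T : X →ₗ[ℂ] X) ^ (n + 1)) x = 0 := by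
  simp only [generalisedKernel, mem_iUnion, mem_ofPred_eq, ← ContinuousLinearMap.toLinearMap_pow,
    ContinuousLinearMap.coe_coe, exists_prop]
  exact ⟨fun ⟨n, hn, hx⟩ => ⟨n - 1, by rwa [Nat.sub_add_cancel hn]⟩,
    fun ⟨n, hx⟩ => ⟨n + 1, n.succ_pos, hx⟩⟩

theorem exists_isStrictlyTriangularAlong_dense_span [TopologicalSpace.SeparableSpace X]
    {S : X →L[ℂ] X} (hS : Dense (generalisedKernel S)) :
    ∃ w : ℕ → X, Dense (Submodule.span ℂ (range w) : Set X) ∧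
      IsStrictlyTriangularAlong (S : X →ₗ[ℂ] X) w := by
  have : SecondCountableTopology X := UniformSpace.secondCountable_of_separable X
  obtain ⟨t, hts, htc, htd⟩ := hS.exists_countable_dense_subset
  obtain ⟨v, rfl⟩ := htc.exists_eq_range htd.nonempty
  have hchain : ∀ j, ∃ y : ℕ → X,
      IsStrictlyTriangularAlong (S : X →ₗ[ℂ] X) y ∧ v j ∈ range y := fun j =>
    have ⟨_, hn⟩ := mem_generalisedKernel.1 (hts (mem_range_self j))
    exists_isStrictlyTriangularAlong_of_pow_apply_eq_zero hn
  choose y hy hvy using hchain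
  refine ⟨_, htd.mono (range_subset_iff.2 fun j => ?_), IsStrictlyTriangularAlong.unpair hy⟩
  obtain ⟨i, hi⟩ := hvy j
  exact Submodule.subset_span ⟨Nat.pair j i, by simpa using hi⟩

theorem not_finiteDimensional_of_dense {𝕜 E : Type*} [NontriviallyNormedField 𝕜]
    [CompleteSpace 𝕜] [AddCommGroup E] [Module 𝕜 E] [TopologicalSpace E] [IsTopologicalAddGroup E]
    [ContinuousSMul 𝕜 E] [T2Space E] (hE : ¬ FiniteDimensional 𝕜 E) {p : Submodule 𝕜 E}
    (hp : Dense (p : Set E)) : ¬ FiniteDimensional 𝕜 p := by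
  intro hfin
  have htop : p = ⊤ :=
    SetLike.coe_injective (p.closed_of_finiteDimensional.closure_eq.symm.trans hp.closure_eq)
  subst htop
  exact hE Submodule.topEquiv.finiteDimensional

theorem exists_linearIndependent_isStrictlyTriangularAlong [TopologicalSpace.SeparableSpace X]
    (hX : ¬ FiniteDimensional ℂ X) {S : X →L[ℂ] X} (hS : Dense (generalisedKernel S)) :
    ∃ e : ℕ → X, LinearIndependent ℂ e ∧ Dense (Submodule.span ℂ (range e) : Set X) ∧
      IsStrictlyTriangularAlong (S : X →ₗ[ℂ] X) e := by
  obtain ⟨w, hd, hSw⟩ := exists_isStrictlyTriangularAlong_dense_span hS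
  obtain ⟨φ, hmono, hli, hφ⟩ :=
    exists_linearIndependent_comp_initialSpan_eq (not_finiteDimensional_of_dense hX hd)
  have hspan : Submodule.span ℂ (range w) ≤ Submodule.span ℂ (range (w ∘ φ)) :=
    span_range_le_of_initialSpan_le fun n =>
      calc initialSpan ℂ w n ≤ initialSpan ℂ w (φ n) := initialSpan_mono (hmono.le_apply)
        _ = initialSpan ℂ (w ∘ φ) n := (hφ n).symm
        _ ≤ Submodule.span ℂ (range (w ∘ φ)) := initialSpan_le_span_range n
  exact ⟨w ∘ φ, hli, hd.mono hspan, fun k => (hφ k).symm ▸ hSw (φ k)⟩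

end GeneralisedKernel

section Perturbation

section StrongDual

variable {𝕜 X : Type*} [Field 𝕜] [TopologicalSpace 𝕜] [IsTopologicalRing 𝕜] [AddCommGroup X]
  [Module 𝕜 X] [TopologicalSpace X] [SeparatingDual 𝕜 X]

theorem exists_strongDual_apply_eq_of_linearIndependent {ι : Type*} [Finite ι] {v : ι → X}
    (hv : LinearIndependent 𝕜 v) (a : ι → 𝕜) : ∃ f : StrongDual 𝕜 X, ∀ i, f (v i) = a i := by
  obtain ⟨f, hf⟩ := SeparatingDual.dualMap_surjective_iff.2 hv (Finsupp.linearCombination 𝕜 a)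
  exact ⟨f, fun i => by simpa using LinearMap.congr_fun hf (Finsupp.single i 1)⟩

theorem exists_upperTriangular_strongDual {e : ℕ → X} (he : LinearIndependent 𝕜 e) :
    ∃ f : ℕ → StrongDual 𝕜 X, (∀ k, f k (e k) = 1) ∧ ∀ i k, i < k → f k (e i) = 0 := by
  have hf : ∀ k, ∃ f : StrongDual 𝕜 X, ∀ i : Iic k, f (e i) = (Pi.single k 1 : ℕ → 𝕜) i :=
    fun k => exists_strongDual_apply_eq_of_linearIndependent
      (he.comp ((↑) : Iic k → ℕ) Subtype.val_injective) _
  choose f hf using hf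
  refine ⟨f, fun k => ?_, fun i k hik => ?_⟩
  · rw [hf k ⟨k, self_mem_Iic⟩, Pi.single_eq_same]
  · rw [hf k ⟨i, hik.le⟩, Pi.single_eq_of_ne hik.ne]

end StrongDual

variable {𝕜 X : Type*} [NontriviallyNormedField 𝕜]

theorem exists_summable_smul_add_ne_zero {E : Type*} [NormedAddCommGroup E] [NormedSpace 𝕜 E]
    [CompleteSpace E] (R : ℕ → E) (a : ℕ → 𝕜) {ε : ℝ} (hε : 0 < ε) :
    ∃ δ : ℕ → 𝕜, (∀ k, a k + δ k ≠ 0) ∧ Summable (fun k => δ k • R k) ∧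
      ‖∑' k, δ k • R k‖ < ε := by
  obtain ⟨η, hη, s, hs, hsε⟩ := posSumOfEncodable (half_pos hε) ℕ
  have hδ : ∀ k, ∃ δ : 𝕜, a k + δ ≠ 0 ∧ ‖δ • R k‖ ≤ η k := fun k => by
    have hopen : IsOpen {δ : 𝕜 | ‖δ • R k‖ < η k} :=
      isOpen_lt (continuous_id.smul continuous_const).norm continuous_const
    obtain ⟨δ, hne, hlt⟩ :=
      (dense_compl_singleton (-a k)).exists_mem_open hopen ⟨0, by simpa using hη k⟩
    exact ⟨δ, fun h => hne (eq_neg_of_add_eq_zero_right h), hlt.le⟩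
  choose δ hne hle using hδ
  refine ⟨δ, hne, .of_norm_bounded hs.summable hle, ?_⟩
  calc ‖∑' k, δ k • R k‖ ≤ s := tsum_of_norm_bounded hs hle
    _ ≤ ε / 2 := hsε
    _ < ε := half_lt_self hε

variable [NormedAddCommGroup X] [NormedSpace 𝕜 X] {e : ℕ → X}

theorem tsum_smulRight_apply {f : ℕ → StrongDual 𝕜 X}
    (hf : ∀ i k, i < k → f k (e i) = 0) {δ : ℕ → 𝕜}
    (hδ : Summable fun k => δ k • (f (k + 1)).smulRight (e k)) (m : ℕ) :
    (∑' k, δ k • (f (k + 1)).smulRight (e k)) (e m) =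
      ∑ k ∈ Finset.range m, (δ k * f (k + 1) (e m)) • e k := by
  calc (∑' k, δ k • (f (k + 1)).smulRight (e k)) (e m)
      = ∑' k, (δ k * f (k + 1) (e m)) • e k := by
        simpa only [ContinuousLinearMap.apply_apply, smul_apply,
          ContinuousLinearMap.smulRight_apply, smul_smul]
          using (ContinuousLinearMap.apply 𝕜 X (e m)).map_tsum hδ
    _ = ∑ k ∈ Finset.range m, (δ k * f (k + 1) (e m)) • e k := by
        refine tsum_eq_sum fun k hk => ?_
        have hmk : m < k + 1 := by simpa [Nat.lt_succ_iff] using hk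
        rw [hf m (k + 1) hmk, mul_zero, zero_smul]

/-- The perturbation is `∑ k, δ k • f (k + 1) (·) • e k`, for functionals `f k` that are upper
triangular with respect to `e` and scalars `δ k` small enough. -/
theorem exists_norm_lt_superdiagonal_ne_zero [CompleteSpace X] [SeparatingDual 𝕜 X]
    (he : LinearIndependent 𝕜 e) (a : ℕ → 𝕜) {ε : ℝ} (hε : 0 < ε) :
    ∃ P : X →L[𝕜] X, ‖P‖ < ε ∧ P (e 0) = 0 ∧
      ∀ k, ∃ b : 𝕜, a k + b ≠ 0 ∧ P (e (k + 1)) - b • e k ∈ initialSpan 𝕜 e k := by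
  obtain ⟨f, hf_one, hf_zero⟩ := exists_upperTriangular_strongDual he
  obtain ⟨δ, hδ, hsum, hlt⟩ := exists_summable_smul_add_ne_zero
    (fun k => (f (k + 1)).smulRight (e k)) a hε
  refine ⟨_, hlt, ?_, fun k => ⟨δ k, hδ k, ?_⟩⟩
  · rw [tsum_smulRight_apply hf_zero hsum, Finset.sum_range_zero]
  · rw [tsum_smulRight_apply hf_zero hsum, Finset.sum_range_succ, hf_one, mul_one,
      add_sub_cancel_right]
    exact Submodule.sum_smul_mem _ _ fun i hi => apply_mem_initialSpan (Finset.mem_range.1 hi)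

theorem mem_closure_isBackwardShiftAlong [CompleteSpace X] [SeparatingDual 𝕜 X]
    (he : LinearIndependent 𝕜 e) {S : X →L[𝕜] X}
    (hS : IsStrictlyTriangularAlong (S : X →ₗ[𝕜] X) e) :
    S ∈ closure {B : X →L[𝕜] X | IsBackwardShiftAlong (B : X →ₗ[𝕜] X) e} := by
  have hdiag : ∀ k, ∃ a : 𝕜, S (e (k + 1)) - a • e k ∈ initialSpan 𝕜 e k := fun k => by
    have hk := hS (k + 1)
    rw [initialSpan_succ] at hk
    obtain ⟨x, hx, y, hy, hxy⟩ := Submodule.mem_sup.1 hk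
    obtain ⟨a, rfl⟩ := Submodule.mem_span_singleton.1 hy
    exact ⟨a, by rwa [← ContinuousLinearMap.coe_coe, ← hxy, add_sub_cancel_right]⟩
  choose a ha using hdiag
  have hS_zero : S (e 0) = 0 := by simpa [initialSpan_zero] using hS 0
  refine Metric.mem_closure_iff.2 fun ε hε => ?_
  obtain ⟨P, hPε, hP_zero, hP⟩ := exists_norm_lt_superdiagonal_ne_zero he a hε
  refine ⟨S + P, ⟨?_, fun k => ?_⟩, by rwa [dist_self_add_right]⟩
  · rw [ContinuousLinearMap.coe_coe, add_apply, hS_zero, hP_zero, add_zero]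
  · obtain ⟨b, hb, hPb⟩ := hP k
    refine ⟨a k + b, hb, ?_⟩
    rw [ContinuousLinearMap.coe_coe, add_apply, add_smul, add_sub_add_comm]
    exact add_mem (ha k) hPb

end Perturbation

section AsymptoticOrbits

section TopologicalModule

variable {𝕜 V : Type*} [Ring 𝕜] [AddCommGroup V] [Module 𝕜 V] [TopologicalSpace V] [ContinuousAdd V]
  [ContinuousConstSMul 𝕜 V]

/-- The pairs of limits of `w k` and `R ^ k (w k)`, for the sequences `w` for which both exist.
They describe which points can be moved near which others by all high powers of `R`. -/
def asymptoticOrbitPairs (R : Module.End 𝕜 V) : Submodule 𝕜 (V × V) where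
  carrier := {p | ∃ w : ℕ → V, Tendsto w atTop (𝓝 p.1) ∧
    Tendsto (fun k => (R ^ k) (w k)) atTop (𝓝 p.2)}
  add_mem' := by
    rintro p q ⟨w, hw, hRw⟩ ⟨w', hw', hRw'⟩
    exact ⟨fun k => w k + w' k, hw.add hw', by
      simpa only [map_add, Prod.snd_add] using hRw.add hRw'⟩
  zero_mem' := ⟨fun _ => 0, tendsto_const_nhds, by
    simpa only [map_zero, Prod.snd_zero] using tendsto_const_nhds⟩
  smul_mem' := by
    rintro c p ⟨w, hw, hRw⟩
    exact ⟨fun k => c • w k, hw.const_smul c, by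
      simpa only [map_smul, Prod.smul_snd] using hRw.const_smul c⟩

theorem mem_asymptoticOrbitPairs {R : Module.End 𝕜 V} {y z : V} :
    (y, z) ∈ asymptoticOrbitPairs R ↔ ∃ w : ℕ → V, Tendsto w atTop (𝓝 y) ∧
      Tendsto (fun k => (R ^ k) (w k)) atTop (𝓝 z) := Iff.rfl

end TopologicalModule

section Rotation

variable {𝕜 V : Type*} [NormedField 𝕜] [NormedAddCommGroup V] [NormedSpace 𝕜 V]
  {R : Module.End 𝕜 V} {z : 𝕜} {x : V}

theorem prod_zero_mem_asymptoticOrbitPairs_smul (hz : ‖z‖ = 1)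
    (hx : (x, 0) ∈ asymptoticOrbitPairs R) : (x, 0) ∈ asymptoticOrbitPairs (z • R) := by
  obtain ⟨w, hw, hRw⟩ := mem_asymptoticOrbitPairs.1 hx
  refine mem_asymptoticOrbitPairs.2 ⟨w, hw, tendsto_zero_iff_norm_tendsto_zero.2 ?_⟩
  simpa [smul_pow, norm_smul, hz] using hRw.norm

theorem zero_prod_mem_asymptoticOrbitPairs_smul (hz : ‖z‖ = 1)
    (hx : (0, x) ∈ asymptoticOrbitPairs R) : (0, x) ∈ asymptoticOrbitPairs (z • R) := by
  obtain ⟨w, hw, hRw⟩ := mem_asymptoticOrbitPairs.1 hx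
  have hz_ne : z ≠ 0 := norm_ne_zero_iff.1 (hz ▸ one_ne_zero)
  refine mem_asymptoticOrbitPairs.2 ⟨fun k => (z ^ k)⁻¹ • w k, ?_, ?_⟩
  · rw [tendsto_zero_iff_norm_tendsto_zero]
    simpa [norm_smul, hz] using hw.norm
  · simpa [smul_pow, smul_smul, hz_ne] using hRw

end Rotation

theorem isMixingOperator_of_dense_asymptoticOrbitPairs {X : Type*} [NormedAddCommGroup X]
    [NormedSpace ℂ X] {R : X →L[ℂ] X} {D : Submodule ℂ X} (hD : Dense (D : Set X))
    (hleft : ∀ x ∈ D, (x, 0) ∈ asymptoticOrbitPairs (R : X →ₗ[ℂ] X))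
    (hright : ∀ x ∈ D, (0, x) ∈ asymptoticOrbitPairs (R : X →ₗ[ℂ] X)) : IsMixingOperator R := by
  intro U V hU hV hUn hVn
  obtain ⟨y, hyD, hyU⟩ := hD.exists_mem_open hU hUn
  obtain ⟨z, hzD, hzV⟩ := hD.exists_mem_open hV hVn
  have hyz : (y, z) ∈ asymptoticOrbitPairs (R : X →ₗ[ℂ] X) := by
    simpa using add_mem (hleft y hyD) (hright z hzD)
  obtain ⟨w, hw, hRw⟩ := mem_asymptoticOrbitPairs.1 hyz
  obtain ⟨N, hN⟩ := eventually_atTop.1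
    ((hw.eventually (hU.mem_nhds hyU)).and (hRw.eventually (hV.mem_nhds hzV)))
  refine ⟨N, fun n hn => ⟨_, mem_image_of_mem _ (hN n hn.le).1, ?_⟩⟩
  rw [← ContinuousLinearMap.coe_coe, ContinuousLinearMap.toLinearMap_pow]
  exact (hN n hn.le).2

end AsymptoticOrbits

section Newton

open Finset.HasAntidiagonal (antidiagonal)

section Algebra

variable {R V : Type*} [CommRing R] [AddCommGroup V] [Module R V]

/-- The Newton interpolation of `f` at `t` along the orbit of `u` under `T`: the sum of
`Δ^i f t • T^j u` over `i + j = N`. On functions with `Δ^(N + 1) f = 0` it intertwines the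
translation `t ↦ t + 1` with `1 + T`, provided `T^(N + 1) u = 0`. -/
def newtonVector (T : Module.End R V) (u : V) (N : ℕ) (f : R → R) (t : R) : V :=
  ∑ p ∈ antidiagonal N, (fwdDiff 1)^[p.1] f t • (T ^ p.2) u

variable {T : Module.End R V} {u : V} {N : ℕ} {f : R → R}

theorem one_add_apply_newtonVector (hu : (T ^ (N + 1)) u = 0) (hf : (fwdDiff 1)^[N + 1] f = 0)
    (t : R) : (1 + T) (newtonVector T u N f t) = newtonVector T u N f (t + 1) := by
  have hshift : ∑ p ∈ antidiagonal N, (fwdDiff 1)^[p.1] f t • (T ^ (p.2 + 1)) u =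
      ∑ p ∈ antidiagonal N, (fwdDiff 1)^[p.1 + 1] f t • (T ^ p.2) u := by
    simpa [hu, hf] using
      (Finset.Nat.sum_antidiagonal_succ' (n := N)
        (f := fun p => (fwdDiff 1)^[p.1] f t • (T ^ p.2) u)).symm.trans
        Finset.Nat.sum_antidiagonal_succ
  have hT : T (newtonVector T u N f t) =
      ∑ p ∈ antidiagonal N, (fwdDiff 1)^[p.1 + 1] f t • (T ^ p.2) u := by
    simp only [newtonVector, map_sum, map_smul, ← hshift, pow_succ', Module.End.mul_apply]
  rw [LinearMap.add_apply, Module.End.one_apply, hT, newtonVector, newtonVector,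
    ← Finset.sum_add_distrib]
  refine Finset.sum_congr rfl fun p _ => ?_
  rw [← add_smul, Function.iterate_succ_apply', fwdDiff, add_sub_cancel]

theorem one_add_pow_apply_newtonVector (hu : (T ^ (N + 1)) u = 0) (hf : (fwdDiff 1)^[N + 1] f = 0)
    (t : R) (k : ℕ) :
    ((1 + T) ^ k) (newtonVector T u N f t) = newtonVector T u N f (t + k) := by
  induction k with
  | zero => simp
  | succ k ih =>
    rw [pow_succ', Module.End.mul_apply, ih, one_add_apply_newtonVector hu hf, add_assoc,
      Nat.cast_succ]

theorem newtonVector_zero (t : R) : newtonVector T u N 0 t = 0 :=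
  Finset.sum_eq_zero fun p _ => by simp [fwdDiff_iter_eq_sum_shift]

end Algebra

theorem tendsto_newtonVector {R V α : Type*} [CommRing R] [TopologicalSpace R]
    [IsTopologicalRing R] [AddCommGroup V] [Module R V] [TopologicalSpace V] [ContinuousAdd V]
    [ContinuousSMul R V] (T : Module.End R V) (u : V) (N : ℕ) {l : Filter α} {f : α → R → R}
    {t : α → R} {g : R → R} {s : R}
    (h : ∀ j : ℕ, Tendsto (fun c => f c (t c + j)) l (𝓝 (g (s + j)))) :
    Tendsto (fun c => newtonVector T u N (f c) (t c)) l (𝓝 (newtonVector T u N g s)) := by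
  refine tendsto_finsetSum _ fun p _ => Tendsto.smul_const ?_ ((T ^ p.2) u)
  simp only [fwdDiff_iter_eq_sum_shift, nsmul_one]
  exact tendsto_finsetSum _ fun j _ => (h j).const_smul _

end Newton

section Cutoff

open Polynomial

/-- A polynomial close to `q` near `0` and close to `0` near `c`, when `c` is large and
`q.natDegree ≤ n`. For `c = 0` it is `q` itself, since `0⁻¹ = 0`. -/
noncomputable def cutoff {K : Type*} [Field K] (q : K[X]) (n : ℕ) (c : K) : K[X] :=
  q * (1 - C c⁻¹ * X) ^ (n + 1)

theorem natDegree_cutoff_le {K : Type*} [Field K] {q : K[X]} {n : ℕ} (hq : q.natDegree ≤ n)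
    (c : K) : (cutoff q n c).natDegree ≤ 2 * n + 1 := by
  have hlin : (1 - C c⁻¹ * X).natDegree ≤ 1 := by compute_degree
  calc (cutoff q n c).natDegree ≤ n + (n + 1) * 1 :=
        natDegree_mul_le_of_le hq (natDegree_pow_le_of_le (n + 1) hlin)
    _ = 2 * n + 1 := by ring

variable {𝕜 : Type*} [NormedField 𝕜]

theorem tendsto_eval_cutoff (q : 𝕜[X]) (n : ℕ) (x : 𝕜) :
    Tendsto (fun c => (cutoff q n c).eval x) (cobounded 𝕜) (𝓝 (q.eval x)) := by
  simpa [cutoff] using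
    (((tendsto_inv₀_cobounded.mul_const x).const_sub 1).pow (n + 1)).const_mul (q.eval x)

theorem tendsto_eval_cutoff_add {q : 𝕜[X]} {n : ℕ} (hq : q.natDegree ≤ n) (x : 𝕜) :
    Tendsto (fun c => (cutoff q n c).eval (c + x)) (cobounded 𝕜) (𝓝 0) := by
  have hdeg : (q.comp (X + C x)).degree < (X ^ (n + 1) : 𝕜[X]).degree := by
    refine degree_lt_degree ?_
    rw [natDegree_comp, natDegree_X_add_C, mul_one, natDegree_X_pow]
    exact Nat.lt_succ_of_le hq
  have hlim := (isLittleO_cobounded_of_degree_lt hdeg).tendsto_div_nhds_zero.mul_const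
    ((-x) ^ (n + 1))
  rw [zero_mul] at hlim
  refine hlim.congr' ?_
  filter_upwards [eventually_ne_cobounded 0] with c hc
  have hfactor : 1 - c⁻¹ * (c + x) = -x / c := by
    field_simp
    ring
  simp only [cutoff, eval_mul, eval_comp, eval_pow, eval_sub, eval_add, eval_one, eval_C, eval_X,
    hfactor, div_pow]
  ring

end Cutoff

section NewtonCutoff

open Polynomial

theorem one_add_pow_apply_newtonVector_cutoff {K V : Type*} [Field K] [AddCommGroup V] [Module K V]
    {T : Module.End K V} {u : V} {q : K[X]} {n : ℕ} (hu : (T ^ (2 * n + 2)) u = 0)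
    (hq : q.natDegree ≤ n) (c t : K) (k : ℕ) :
    ((1 + T) ^ k) (newtonVector T u (2 * n + 1) (cutoff q n c).eval t) =
      newtonVector T u (2 * n + 1) (cutoff q n c).eval (t + k) :=
  one_add_pow_apply_newtonVector hu
    (fwdDiff_iter_eq_zero_of_degree_lt (Nat.lt_succ_of_le (natDegree_cutoff_le hq c))) t k

/-- The polynomial is the binomial coefficient `t.choose n`. -/
theorem exists_natDegree_le_fwdDiff_iter_eq_ite (K : Type*) [Field K] [CharZero K] (n : ℕ) :
    ∃ q : K[X], q.natDegree ≤ n ∧ ∀ i, (fwdDiff 1)^[i] q.eval 0 = if i = n then 1 else 0 := by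
  set q : K[X] := C (n.factorial : K)⁻¹ * descPochhammer K n with hq
  have heval : ∀ k : ℕ, q.eval (k : K) = k.choose n := fun k => by
    rw [hq, eval_mul, eval_C, descPochhammer_eval_eq_descFactorial,
      Nat.descFactorial_eq_factorial_mul_choose, Nat.cast_mul,
      inv_mul_cancel_left₀ (Nat.cast_ne_zero.2 n.factorial_ne_zero)]
  refine ⟨q, (natDegree_C_mul_le _ _).trans (descPochhammer_natDegree K n).le, fun i => ?_⟩
  have hchoose := congrArg (Int.cast : ℤ → K) (fwdDiff_iter_choose_zero n i)
  rw [fwdDiff_iter_eq_sum_shift] at hchoose ⊢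
  simpa [heval] using hchoose

theorem exists_newtonVector_eq_pow_apply {K V : Type*} [Field K] [CharZero K]
    [AddCommGroup V] [Module K V] (T : Module.End K V) (u : V) (n : ℕ) :
    ∃ q : K[X], q.natDegree ≤ n ∧ newtonVector T u (2 * n + 1) q.eval 0 = (T ^ (n + 1)) u := by
  obtain ⟨q, hdeg, hq⟩ := exists_natDegree_le_fwdDiff_iter_eq_ite K n
  refine ⟨q, hdeg, ?_⟩
  rw [newtonVector, Finset.sum_eq_single (n, n + 1)]
  · rw [hq, if_pos rfl, one_smul]
  · rintro ⟨i, j⟩ hij hne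
    have hi : i ≠ n := by
      rintro rfl
      have := Finset.HasAntidiagonal.mem_antidiagonal.1 hij
      exact hne (Prod.ext rfl (by omega))
    rw [hq, if_neg hi, zero_smul]
  · intro hmem
    exact absurd (Finset.HasAntidiagonal.mem_antidiagonal.2 (by dsimp only; omega)) hmem

section Limits

variable {𝕜 V : Type*} [NormedField 𝕜] [AddCommGroup V] [Module 𝕜 V] [TopologicalSpace V]
  [ContinuousAdd V] [ContinuousSMul 𝕜 V]

theorem tendsto_newtonVector_cutoff (T : Module.End 𝕜 V) (u : V) (N n : ℕ) (q : 𝕜[X]) :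
    Tendsto (fun c => newtonVector T u N (cutoff q n c).eval 0) (cobounded 𝕜)
      (𝓝 (newtonVector T u N q.eval 0)) :=
  tendsto_newtonVector T u N fun j => tendsto_eval_cutoff q n (0 + j)

theorem tendsto_newtonVector_cutoff_self (T : Module.End 𝕜 V) (u : V) (N : ℕ)
    {n : ℕ} {q : 𝕜[X]}
    (hq : q.natDegree ≤ n) :
    Tendsto (fun c => newtonVector T u N (cutoff q n c).eval c) (cobounded 𝕜) (𝓝 0) := by
  rw [← newtonVector_zero (T := T) (u := u) (N := N) (0 : 𝕜)]
  exact tendsto_newtonVector T u N fun j => tendsto_eval_cutoff_add hq (j : 𝕜)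

end Limits

variable {𝕜 V : Type*} [RCLike 𝕜] [AddCommGroup V] [Module 𝕜 V] [TopologicalSpace V]
  [ContinuousAdd V] [ContinuousSMul 𝕜 V] {T : Module.End 𝕜 V} {u : V} {n : ℕ} {q : 𝕜[X]}

theorem newtonVector_prod_zero_mem_asymptoticOrbitPairs (hu : (T ^ (2 * n + 2)) u = 0)
    (hq : q.natDegree ≤ n) :
    (newtonVector T u (2 * n + 1) q.eval 0, 0) ∈ asymptoticOrbitPairs (1 + T) := by
  have hk : Tendsto ((↑) : ℕ → 𝕜) atTop (cobounded 𝕜) := tendsto_natCast_atTop_cobounded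
  refine mem_asymptoticOrbitPairs.2
    ⟨_, (tendsto_newtonVector_cutoff T u (2 * n + 1) n q).comp hk, ?_⟩
  refine ((tendsto_newtonVector_cutoff_self T u (2 * n + 1) hq).comp hk).congr fun k => ?_
  rw [Function.comp_apply, Function.comp_apply, one_add_pow_apply_newtonVector_cutoff hu hq,
    zero_add]

theorem zero_prod_newtonVector_mem_asymptoticOrbitPairs (hu : (T ^ (2 * n + 2)) u = 0)
    (hq : q.natDegree ≤ n) :
    (0, newtonVector T u (2 * n + 1) q.eval 0) ∈ asymptoticOrbitPairs (1 + T) := by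
  have hk : Tendsto (fun k : ℕ => -(k : 𝕜)) atTop (cobounded 𝕜) :=
    tendsto_neg_cobounded.comp tendsto_natCast_atTop_cobounded
  refine mem_asymptoticOrbitPairs.2
    ⟨_, (tendsto_newtonVector_cutoff_self T u (2 * n + 1) hq).comp hk, ?_⟩
  refine ((tendsto_newtonVector_cutoff T u (2 * n + 1) n q).comp hk).congr fun k => ?_
  rw [Function.comp_apply, Function.comp_apply, one_add_pow_apply_newtonVector_cutoff hu hq,
    neg_add_cancel]

theorem pow_apply_mem_asymptoticOrbitPairs {n : ℕ} (hu : (T ^ (2 * n)) u = 0) :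
    ((T ^ n) u, 0) ∈ asymptoticOrbitPairs (1 + T) ∧
      (0, (T ^ n) u) ∈ asymptoticOrbitPairs (1 + T) := by
  cases n with
  | zero =>
    have hu_zero : u = 0 := hu
    rw [hu_zero, map_zero]
    exact ⟨zero_mem _, zero_mem _⟩
  | succ n =>
    obtain ⟨q, hdeg, hq⟩ := exists_newtonVector_eq_pow_apply T u n
    rw [← hq]
    exact ⟨newtonVector_prod_zero_mem_asymptoticOrbitPairs hu hdeg,
      zero_prod_newtonVector_mem_asymptoticOrbitPairs hu hdeg⟩

theorem extendedKernel_le_comap_asymptoticOrbitPairs (T : Module.End 𝕜 V) :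
    extendedKernel T ≤ (asymptoticOrbitPairs (1 + T)).comap (LinearMap.inl 𝕜 V V) ⊓
      (asymptoticOrbitPairs (1 + T)).comap (LinearMap.inr 𝕜 V V) := by
  refine iSup_le fun n => ?_
  rintro _ ⟨u, hu, rfl⟩
  exact pow_apply_mem_asymptoticOrbitPairs hu

end NewtonCutoff

theorem isMixingOperator_smul_id_add_of_dense_extendedKernel {X : Type*} [NormedAddCommGroup X]
    [NormedSpace ℂ X] {B : X →L[ℂ] X} (hB : Dense (extendedKernel (B : X →ₗ[ℂ] X) : Set X))
    {z : ℂ} (hz : ‖z‖ = 1) : IsMixingOperator (z • ContinuousLinearMap.id ℂ X + B) := by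
  have hz_ne : z ≠ 0 := norm_ne_zero_iff.1 (hz ▸ one_ne_zero)
  have hfactor : ((z • ContinuousLinearMap.id ℂ X + B : X →L[ℂ] X) : X →ₗ[ℂ] X) =
      z • (1 + z⁻¹ • (B : Module.End ℂ X)) := by
    rw [smul_add, smul_inv_smul₀ hz_ne]
    rfl
  have hpairs := extendedKernel_le_comap_asymptoticOrbitPairs (z⁻¹ • (B : Module.End ℂ X))
  rw [extendedKernel_smul _ (inv_ne_zero hz_ne)] at hpairs
  refine isMixingOperator_of_dense_asymptoticOrbitPairs hB (fun x hx => ?_) fun x hx => ?_ <;>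
    rw [hfactor]
  · exact prod_zero_mem_asymptoticOrbitPairs_smul hz (hpairs hx).1
  · exact zero_prod_mem_asymptoticOrbitPairs_smul hz (hpairs hx).2

theorem theorem3p1 {X : Type*} [NormedAddCommGroup X] [NormedSpace ℂ X] [CompleteSpace X]
    [TopologicalSpace.SeparableSpace X] (hX : ¬ FiniteDimensional ℂ X)
    (S : X →L[ℂ] X) (hS : Dense (generalisedKernel S)) :
    S ∈ closure {B : X →L[ℂ] X | IsGeneralisedBackwardShift 1 B} ∧
    ∀ z : ℂ, ‖z‖ = 1 →
      z • ContinuousLinearMap.id ℂ X + S ∈ closure {T : X →L[ℂ] X | IsMixingOperator T} := by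
  obtain ⟨e, hli, hd, hSe⟩ := exists_linearIndependent_isStrictlyTriangularAlong hX hS
  have hclosure := mem_closure_isBackwardShiftAlong hli hSe
  refine ⟨closure_mono (fun B hB => isGeneralisedBackwardShift_one hli hd hB) hclosure,
    fun z hz => map_mem_closure (continuous_const_add _) hclosure fun B hB => ?_⟩
  exact isMixingOperator_smul_id_add_of_dense_extendedKernel
    (hd.mono hB.span_range_le_extendedKernel) hz
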